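/- \textbf{Setting.} An instance of the stochastic probing problem consists of a finite ground set $X$, a probability $p_e\in[0,1]$ for every $e\in X$, a prefix-closed family $\mathcal F$ of finite sequences over $X$ containing the empty sequence (every prefix of a sequence in $\mathcal F$ lies in $\mathcal F$), and an objective $f:2^X\to\mathbb R_{\ge 0}$ with $f(\emptyset)=0$. Every element $e$ is active independently with probability $p_e$, and whether it is active is revealed by probing it. Put $f^{\max}(S)=\max_{T\subseteq S} f(T)$. A sequence is feasible if it lies in $\mathcal F$ and has no repeated element. An adaptive strategy is a binary decision tree that probes an element at each internal node and branches on whether this element is active, such that the sequence of probed elements on every root-leaf path is feasible; its value is $\mathbb E[f^{\max}(A)]$, where $A$ is the random set of active elements on the path followed. A non-adaptive strategy is a feasible sequence; if $S$ is its set of elements, its value is $\mathbb E[f^{\max}(R)]$, where $R\subseteq S$ contains each $e\in S$ independently with probability $p_e$. The adaptivity gap of the instance is the supremum of the values of adaptive strategies divided by the supremum of the values of non-adaptive strategies (with $0/0=0$ and $a/0=\infty$ for $a>0$). A function $f:2^X\to\mathbb R$ is monotone XOS if for some $W$ there are vectors $\mathbf a_1,\dots,\mathbf a_W\in\mathbb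 R_{\ge0}^X$ with $f(S)=\max_{i}\sum_{e\in S}\mathbf a_i(e)$ for all $S\subseteq X$; its width is the least such $W$. For $k\ge 1$, the $k$-ary tree instance is the following. The ground set is the set of edges of the complete rooted $k$-ary tree of depth $k$; every edge is active with probability $1/k$; a sequence of edges belongs to $\mathcal F$ if there is a root-leaf path such that every edge of the sequence has at least one endpoint on this path; and $f(S)=\max_l |P_l\cap S|$, where $l$ ranges over the leaves and $P_l$ is the set of edges of the path from the root to $l$. \textbf{Theorem (XOS functions).} (1) There is an absolute constant $C>0$ such that every instance whose objective is a monotone XOS function of width $W$ has adaptivity gap at most $C(1+\log W)$. (So the gap is $O(\log W)$ for $W\ge2$.) (2) There are absolute constants $c,c_1,c_2>0$ such that for every $k\ge2$ the objective of the $k$-ary tree instance is a monotone XOS function whose width $W$ satisfies $c_1 n\le W\le c_2 n$, where $n$ is the number of elements of the ground set, and the adaptivity gap of this instance is at least $c\,\dfrac{\log W}{\log\log W}$. -/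

import Mathlib

open scoped ENNReal

noncomputable section

/-- An instance of the stochastic probing problem on the finite ground set `X`: activation
probabilities, a prefix-closed family of probing sequences (containing the empty sequence), and a
non-negative objective `f` with `f ∅ = 0`. -/
structure ProbingInstance (X : Type*) where
  p : X → ℝ
  p_nonneg : ∀ e, 0 ≤ p e
  p_le_one : ∀ e, p e ≤ 1
  allowed : Set (List X)
  nil_allowed : [] ∈ allowed
  prefix_closed : ∀ σ ∈ allowed, ∀ τ : List X, τ <+: σ → τ ∈ allowed
  f : Finset X → ℝ
  f_nonneg : ∀ S, 0 ≤ f S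
  f_empty : f ∅ = 0

/-- Binary decision trees: each internal node carries the element that is probed there, followed by
the subtree for the outcome `active` and the subtree for the outcome `inactive`. -/
inductive StrategyTree (X : Type*) where
  | leaf : StrategyTree X
  | node (e : X) (yes no : StrategyTree X) : StrategyTree X

/-- The sequences of elements probed along the root-leaf paths of a tree. -/
def StrategyTree.rootLeafPaths {X : Type*} : StrategyTree X → List (List X)
  | .leaf => [[]]
  | .node e yes no => (yes.rootLeafPaths ++ no.rootLeafPaths).map (fun P => e :: P)

/-- The expectation of `g A`, where `A` is the set of active elements on the root-leaf path that is
followed when every probed element `e` is active with probability `p e`, independently. -/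
def StrategyTree.expect {X : Type*} [DecidableEq X] (p : X → ℝ) :
    StrategyTree X → (Finset X → ℝ) → ℝ
  | .leaf, g => g ∅
  | .node e yes no, g =>
      p e * yes.expect p (fun A => g (insert e A)) + (1 - p e) * no.expect p g

/-- `fMax f S` is the largest value `f T` of a subset `T ⊆ S`. -/
def fMax {X : Type*} (f : Finset X → ℝ) (S : Finset X) : ℝ :=
  S.powerset.sup' ⟨∅, Finset.empty_mem_powerset S⟩ f

/-- The expectation of `g R`, where the random set `R ⊆ S` contains each `e ∈ S` independently with
probability `p e`. -/
def expectRandomSubset {X : Type*} [DecidableEq X] (p : X → ℝ) (S : Finset X)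
    (g : Finset X → ℝ) : ℝ :=
  ∑ R ∈ S.powerset, (∏ e ∈ R, p e) * (∏ e ∈ S \ R, (1 - p e)) * g R

namespace ProbingInstance

variable {X : Type*} [DecidableEq X]

/-- A probing sequence is feasible if no element is probed twice and the constraint allows it. -/
def FeasibleSeq (I : ProbingInstance X) (σ : List X) : Prop :=
  σ.Nodup ∧ σ ∈ I.allowed

/-- A tree is a feasible adaptive strategy if all its root-leaf paths are feasible. -/
def FeasibleTree (I : ProbingInstance X) (T : StrategyTree X) : Prop :=
  ∀ P ∈ T.rootLeafPaths, I.FeasibleSeq P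

/-- Expected value of an adaptive strategy. -/
def adap (I : ProbingInstance X) (T : StrategyTree X) : ℝ :=
  T.expect I.p (fMax I.f)

/-- Expected value of the non-adaptive strategy that probes the sequence `σ`. -/
def nonadap (I : ProbingInstance X) (σ : List X) : ℝ :=
  expectRandomSubset I.p σ.toFinset (fMax I.f)

/-- The optimal adaptive value. -/
def adaptiveOpt (I : ProbingInstance X) : ℝ≥0∞ :=
  ⨆ (T : StrategyTree X) (_ : I.FeasibleTree T), ENNReal.ofReal (I.adap T)

/-- The optimal non-adaptive value. -/
def nonadaptiveOpt (I : ProbingInstance X) : ℝ≥0∞ :=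
  ⨆ (σ : List X) (_ : I.FeasibleSeq σ), ENNReal.ofReal (I.nonadap σ)

/-- The adaptivity gap, with `0 / 0 = 0` and `a / 0 = ∞` for `a > 0`. -/
def adaptivityGap (I : ProbingInstance X) : ℝ≥0∞ :=
  I.adaptiveOpt / I.nonadaptiveOpt

end ProbingInstance

/-- `f` is the maximum of `W` linear functions with non-negative coefficients. -/
def IsMaxOfLinear {X : Type*} (f : Finset X → ℝ) (W : ℕ) : Prop :=
  ∃ a : Fin W → X → ℝ, (∀ i e, 0 ≤ a i e) ∧
    ∀ S : Finset X, IsGreatest (Set.range fun i => ∑ e ∈ S, a i e) (f S)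

/-- Monotone XOS functions. -/
def IsMonotoneXOS {X : Type*} (f : Finset X → ℝ) : Prop :=
  ∃ W : ℕ, IsMaxOfLinear f W

/-- The width of a monotone XOS function: the least `W` such that it is a maximum of `W` linear
functions. -/
def xosWidth {X : Type*} (f : Finset X → ℝ) : ℕ :=
  sInf {W : ℕ | IsMaxOfLinear f W}

/-- The edges of the complete `k`-ary tree of depth `k`. The vertices at depth `d` are the words of
length `d` over `Fin k`; `⟨i, w⟩` is the edge from the vertex `w 0, …, w (i - 1)` at depth `i` to
its child `w 0, …, w i` at depth `i + 1`. -/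
abbrev KaryEdge (k : ℕ) : Type := Σ i : Fin k, (Fin (i.val + 1) → Fin k)

/-- The lower endpoint of `e` lies on the path from the root to the leaf `l`. Equivalently, the edge
`e` belongs to this path. -/
def KaryEdge.LowerOnPath {k : ℕ} (l : Fin k → Fin k) (e : KaryEdge k) : Prop :=
  ∀ j : Fin (e.1.val + 1), e.2 j = l (Fin.castLE e.1.isLt j)

/-- The upper endpoint of `e` lies on the path from the root to the leaf `l`. -/
def KaryEdge.UpperOnPath {k : ℕ} (l : Fin k → Fin k) (e : KaryEdge k) : Prop :=
  ∀ j : Fin e.1.val, e.2 j.castSucc = l (Fin.castLE e.1.isLt j.castSucc)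

open Classical in
/-- The edges of the path from the root to the leaf `l`. -/
def karyPath {k : ℕ} (l : Fin k → Fin k) : Finset (KaryEdge k) :=
  Finset.univ.filter (KaryEdge.LowerOnPath l)

/-- The `k`-ary tree instance: every edge is active with probability `1 / k`, one may probe edges as
long as some root-leaf path meets all of them in at least one endpoint, and the value of a set of
edges is the largest number of them on a common root-leaf path. -/
def karyInstance (k : ℕ) : ProbingInstance (KaryEdge k) where
  p := fun _ => 1 / (k : ℝ)
  p_nonneg := fun _ => by positivity
  p_le_one := fun e => by
    have h : (1 : ℝ) ≤ k := by exact_mod_cast Nat.one_le_of_lt e.1.isLt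
    exact (div_le_one (by linarith)).2 h
  allowed := {σ | ∃ l : Fin k → Fin k, ∀ e ∈ σ, e.UpperOnPath l ∨ e.LowerOnPath l}
  nil_allowed := ⟨id, by simp⟩
  prefix_closed := by
    rintro σ ⟨l, hl⟩ τ hτ
    exact ⟨l, fun e he => hl e (hτ.subset he)⟩
  f := fun S => ((Finset.univ.sup fun l : Fin k → Fin k => (karyPath l ∩ S).card : ℕ) : ℝ)
  f_nonneg := fun _ => Nat.cast_nonneg _
  f_empty := by simp

end

/-! Upper bound. Let `N > 0` bound all non-adaptive values. Every root-leaf path of a decision tree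
is itself a non-adaptive strategy, so `N` controls the means along it. Split the elements at `f {e}
= 2 * N`. On each path some large element is active with probability at most 1/2, which bounds the
mean total value of the large elements by `2 * N` (`sum_large_le_of_expectRandomSubset_le`). On the
small ones the linear functions, divided by `2 * N`, have coefficients at most 1, so each has an
exponential supermartingale (`StrategyTree.expectPath_exp_le_one`). A soft maximum over the `W`
functions then costs only `log W` in units of `2 * N` (`ProbingInstance.adap_le_of_nonadap_le`).

Lower bound. A non-adaptive sequence on the tree stays next to one path, and any other path contains
at most one of its edges off that path, so its value is at most 2 (`nonadap_karyInstance_le`).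
Greedy descent finds an active child edge at each level with probability at least 1/2 and collects
`k / 2` (`half_le_adap_descend`). The width is exactly `k ^ k` (`xosWidth_karyInstance`), so `log W
= k log k` and the gap `k / 4` has the required order. -/

/-! ### Expectations over decision trees and the exponential supermartingale -/

namespace StrategyTree

variable {X : Type*} [DecidableEq X]

/-- The expectation of `h P A`, where `P` is the root-leaf path that is followed and `A` is its set
of active elements. -/
def expectPath (p : X → ℝ) : StrategyTree X → (List X → Finset X → ℝ) → ℝ
  | .leaf, h => h [] ∅
  | .node e yes no, h =>
      p e * yes.expectPath p (fun P A => h (e :: P) (insert e A)) +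
        (1 - p e) * no.expectPath p (fun P A => h (e :: P) A)

theorem expect_eq_expectPath (p : X → ℝ) (T : StrategyTree X) (g : Finset X → ℝ) :
    T.expect p g = T.expectPath p (fun _ A => g A) := by
  induction T generalizing g with
  | leaf => rfl
  | node e yes no ihy ihn => simp only [expect, expectPath, ihy, ihn]

theorem expectPath_mono {p : X → ℝ} (h0 : ∀ e, 0 ≤ p e) (h1 : ∀ e, p e ≤ 1) (T : StrategyTree X)
    {g h : List X → Finset X → ℝ} (hgh : ∀ P ∈ T.rootLeafPaths, ∀ A, g P A ≤ h P A) :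
    T.expectPath p g ≤ T.expectPath p h := by
  induction T generalizing g h with
  | leaf => exact hgh [] (by simp [rootLeafPaths]) ∅
  | node e yes no ihy ihn =>
    have hy := ihy (g := fun P A => g (e :: P) (insert e A)) (h := fun P A => h (e :: P) (insert e A))
      (fun P hP A => hgh _ (by simp [rootLeafPaths, hP]) _)
    have hn := ihn (g := fun P A => g (e :: P) A) (h := fun P A => h (e :: P) A)
      (fun P hP A => hgh _ (by simp [rootLeafPaths, hP]) _)
    exact add_le_add (mul_le_mul_of_nonneg_left hy (h0 e))
      (mul_le_mul_of_nonneg_left hn (sub_nonneg.2 (h1 e)))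

theorem expectPath_const (p : X → ℝ) (T : StrategyTree X) (c : ℝ) :
    T.expectPath p (fun _ _ => c) = c := by
  induction T with
  | leaf => rfl
  | node e yes no ihy ihn => simp only [expectPath, ihy, ihn]; ring

theorem expectPath_add (p : X → ℝ) (T : StrategyTree X) (g h : List X → Finset X → ℝ) :
    T.expectPath p (fun P A => g P A + h P A) = T.expectPath p g + T.expectPath p h := by
  induction T generalizing g h with
  | leaf => rfl
  | node e yes no ihy ihn => simp only [expectPath, ihy, ihn]; ring

theorem expectPath_const_mul (p : X → ℝ) (T : StrategyTree X) (c : ℝ)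
    (g : List X → Finset X → ℝ) :
    T.expectPath p (fun P A => c * g P A) = c * T.expectPath p g := by
  induction T generalizing g with
  | leaf => rfl
  | node e yes no ihy ihn => simp only [expectPath, ihy, ihn]; ring

theorem expectPath_sum {ι : Type*} (p : X → ℝ) (T : StrategyTree X) (s : Finset ι)
    (g : ι → List X → Finset X → ℝ) :
    T.expectPath p (fun P A => ∑ i ∈ s, g i P A) = ∑ i ∈ s, T.expectPath p (g i) := by
  classical
  induction s using Finset.induction_on with
  | empty => simp [expectPath_const]
  | insert i s hi ih => simp only [Finset.sum_insert hi, expectPath_add, ih]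

/-- An inequality is enough below, and it lets the tree estimates hold even for trees that probe an
element twice. -/
theorem sum_insert_le_add {w : X → ℝ} (hw : ∀ e, 0 ≤ w e) (e : X) (A : Finset X) :
    ∑ x ∈ insert e A, w x ≤ w e + ∑ x ∈ A, w x := by
  by_cases he : e ∈ A
  · rw [Finset.insert_eq_of_mem he]; linarith [hw e]
  · rw [Finset.sum_insert he]

/-- The expected weight of the active elements is at most the expected compensator. -/
theorem expectPath_sum_active_le {p : X → ℝ} (h0 : ∀ e, 0 ≤ p e) (h1 : ∀ e, p e ≤ 1)
    (T : StrategyTree X) {w : X → ℝ} (hw : ∀ e, 0 ≤ w e) :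
    T.expectPath p (fun _ A => ∑ e ∈ A, w e) ≤
      T.expectPath p (fun P _ => (P.map fun e => p e * w e).sum) := by
  induction T with
  | leaf => simp [expectPath]
  | node e yes no ihy ihn =>
    have hy : yes.expectPath p (fun _ A => ∑ x ∈ insert e A, w x) ≤
        w e + yes.expectPath p (fun P _ => (P.map fun e => p e * w e).sum) := by
      refine (expectPath_mono h0 h1 yes (h := fun _ A => w e + ∑ x ∈ A, w x)
        fun P _ A => sum_insert_le_add hw e A).trans ?_
      rw [expectPath_add, expectPath_const]
      linarith
    simp only [expectPath, List.map_cons, List.sum_cons]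
    rw [expectPath_add, expectPath_add, expectPath_const, expectPath_const]
    have := mul_le_mul_of_nonneg_left hy (h0 e)
    have := mul_le_mul_of_nonneg_left ihn (sub_nonneg.2 (h1 e))
    linarith

/-- The exponential of the active weight, compensated by twice its mean along the path, is a
supermartingale. -/
theorem expectPath_exp_le_one {p : X → ℝ} (h0 : ∀ e, 0 ≤ p e) (h1 : ∀ e, p e ≤ 1)
    (T : StrategyTree X) {b : X → ℝ} (hb : ∀ e, 0 ≤ b e) (hb1 : ∀ e, b e ≤ 1) :
    T.expectPath p (fun P A => Real.exp (∑ e ∈ A, b e - 2 * (P.map fun e => p e * b e).sum)) ≤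
      1 := by
  induction T with
  | leaf => simp [expectPath]
  | node e yes no ihy ihn =>
    -- The factor 2 of the compensator comes from `exp b - 1 ≤ 2 * b` on `[0, 1]`.
    have hexp : 1 + p e * (Real.exp (b e) - 1) ≤ Real.exp (2 * (p e * b e)) := by
      have h2 := Real.abs_exp_sub_one_le (x := b e) (by rw [abs_of_nonneg (hb e)]; exact hb1 e)
      rw [abs_of_nonneg (hb e)] at h2
      have h3 := mul_le_mul_of_nonneg_left ((le_abs_self _).trans h2) (h0 e)
      have := Real.add_one_le_exp (2 * (p e * b e))
      linarith
    set c := Real.exp (-(2 * (p e * b e))) with hc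
    have hc0 : 0 < c := Real.exp_pos _
    have hy : yes.expectPath p (fun P A => Real.exp (∑ x ∈ insert e A, b x -
        2 * ((e :: P).map fun e => p e * b e).sum)) ≤ c * Real.exp (b e) := by
      refine (expectPath_mono h0 h1 yes (h := fun P A => (c * Real.exp (b e)) *
        Real.exp (∑ e ∈ A, b e - 2 * (P.map fun e => p e * b e).sum)) fun P _ A => ?_).trans ?_
      · rw [hc, ← Real.exp_add, ← Real.exp_add, Real.exp_le_exp, List.map_cons, List.sum_cons]
        have := sum_insert_le_add hb e A
        linarith
      · rw [expectPath_const_mul]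
        exact mul_le_of_le_one_right (by positivity) ihy
    have hn : no.expectPath p (fun P A => Real.exp (∑ x ∈ A, b x -
        2 * ((e :: P).map fun e => p e * b e).sum)) ≤ c := by
      refine (expectPath_mono h0 h1 no (h := fun P A => c *
        Real.exp (∑ e ∈ A, b e - 2 * (P.map fun e => p e * b e).sum)) fun P _ A => ?_).trans ?_
      · rw [hc, ← Real.exp_add, Real.exp_le_exp, List.map_cons, List.sum_cons]
        linarith
      · rw [expectPath_const_mul]
        exact mul_le_of_le_one_right hc0.le ihn
    have hc1 : c * Real.exp (2 * (p e * b e)) = 1 := by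
      rw [hc, ← Real.exp_add]; simp
    simp only [expectPath]
    have e1 := mul_le_mul_of_nonneg_left hy (h0 e)
    have e2 := mul_le_mul_of_nonneg_left hn (sub_nonneg.2 (h1 e))
    have e3 := mul_le_mul_of_nonneg_left hexp hc0.le
    linarith

end StrategyTree

/-! ### Independent random subsets -/

section RandomSubset

variable {X : Type*}

theorem prod_one_sub_mem_Icc {p : X → ℝ} (h0 : ∀ e, 0 ≤ p e) (h1 : ∀ e, p e ≤ 1)
    (S : Finset X) : 0 ≤ ∏ e ∈ S, (1 - p e) ∧ ∏ e ∈ S, (1 - p e) ≤ 1 :=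
  ⟨Finset.prod_nonneg fun e _ => sub_nonneg.2 (h1 e),
    Finset.prod_le_one (fun e _ => sub_nonneg.2 (h1 e)) fun e _ => by linarith [h0 e]⟩

variable [DecidableEq X]

theorem expectRandomSubset_insert (p : X → ℝ) {e : X} {S : Finset X} (he : e ∉ S)
    (g : Finset X → ℝ) :
    expectRandomSubset p (insert e S) g =
      p e * expectRandomSubset p S (fun R => g (insert e R)) +
        (1 - p e) * expectRandomSubset p S g := by
  unfold expectRandomSubset
  rw [Finset.sum_powerset_insert he, add_comm, Finset.mul_sum, Finset.mul_sum]
  congr 1 <;> refine Finset.sum_congr rfl fun R hR => ?_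
  · have heR : e ∉ R := fun h => he (Finset.mem_powerset.1 hR h)
    rw [Finset.prod_insert heR, Finset.insert_sdiff_insert, Finset.sdiff_insert_of_notMem he]
    ring
  · have heR : e ∉ R := fun h => he (Finset.mem_powerset.1 hR h)
    rw [Finset.insert_sdiff_of_notMem _ heR, Finset.prod_insert (by simp [he])]
    ring

theorem expectRandomSubset_mono {p : X → ℝ} (h0 : ∀ e, 0 ≤ p e) (h1 : ∀ e, p e ≤ 1)
    {S : Finset X} {g h : Finset X → ℝ} (hgh : ∀ R ⊆ S, g R ≤ h R) :
    expectRandomSubset p S g ≤ expectRandomSubset p S h :=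
  Finset.sum_le_sum fun R hR => mul_le_mul_of_nonneg_left (hgh R (Finset.mem_powerset.1 hR))
    (mul_nonneg (Finset.prod_nonneg fun e _ => h0 e)
      (Finset.prod_nonneg fun e _ => sub_nonneg.2 (h1 e)))

theorem expectRandomSubset_const (p : X → ℝ) (S : Finset X) (c : ℝ) :
    expectRandomSubset p S (fun _ => c) = c := by
  unfold expectRandomSubset
  rw [← Finset.sum_mul, ← Finset.prod_add]
  simp

theorem expectRandomSubset_add (p : X → ℝ) (S : Finset X) (g h : Finset X → ℝ) :
    expectRandomSubset p S (fun R => g R + h R) =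
      expectRandomSubset p S g + expectRandomSubset p S h := by
  simp only [expectRandomSubset, mul_add, Finset.sum_add_distrib]

theorem expectRandomSubset_sum (p : X → ℝ) (S : Finset X) (w : X → ℝ) :
    expectRandomSubset p S (fun R => ∑ e ∈ R, w e) = ∑ e ∈ S, p e * w e := by
  induction S using Finset.induction_on with
  | empty => simp [expectRandomSubset]
  | insert e S he ih =>
    have : expectRandomSubset p S (fun R => ∑ x ∈ insert e R, w x) =
        expectRandomSubset p S (fun R => w e + ∑ x ∈ R, w x) :=
      Finset.sum_congr rfl fun R hR => by
        beta_reduce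
        rw [Finset.sum_insert fun h => he (Finset.mem_powerset.1 hR h)]
    rw [expectRandomSubset_insert p he, this, expectRandomSubset_add, expectRandomSubset_const,
      ih, Finset.sum_insert he]
    ring

theorem expectRandomSubset_subset {p : X → ℝ} (h0 : ∀ e, 0 ≤ p e) (h1 : ∀ e, p e ≤ 1)
    {S T : Finset X} (hST : S ⊆ T) {g : Finset X → ℝ} (hg : Monotone g) :
    expectRandomSubset p S g ≤ expectRandomSubset p T g := by
  induction T using Finset.induction_on generalizing S g with
  | empty => rw [Finset.subset_empty.1 hST]
  | insert e T he ih =>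
    rw [expectRandomSubset_insert p he]
    have hm : Monotone fun R => g (insert e R) := fun A B hAB =>
      hg (Finset.insert_subset_insert e hAB)
    by_cases heS : e ∈ S
    · rw [← Finset.insert_erase heS, expectRandomSubset_insert p (Finset.notMem_erase e S)]
      have hsub : S.erase e ⊆ T := fun x hx =>
        (Finset.mem_insert.1 (hST (Finset.mem_of_mem_erase hx))).resolve_left
          (Finset.ne_of_mem_erase hx)
      exact add_le_add (mul_le_mul_of_nonneg_left (ih hsub hm) (h0 e))
        (mul_le_mul_of_nonneg_left (ih hsub hg) (sub_nonneg.2 (h1 e)))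
    · have hsub : S ⊆ T := (Finset.subset_insert_iff_of_notMem heS).1 hST
      have a := ih hsub hg
      have b : expectRandomSubset p T g ≤ expectRandomSubset p T (fun R => g (insert e R)) :=
        expectRandomSubset_mono h0 h1 fun R _ => hg (Finset.subset_insert e R)
      have := mul_le_mul_of_nonneg_left (a.trans b) (h0 e)
      have := mul_le_mul_of_nonneg_left a (sub_nonneg.2 (h1 e))
      linarith

/-- The factor next to `L` is the probability that the random subset is nonempty. -/
theorem mul_one_sub_prod_le_expectRandomSubset {p : X → ℝ} (h0 : ∀ e, 0 ≤ p e)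
    (h1 : ∀ e, p e ≤ 1) {S : Finset X} {g : Finset X → ℝ} {L : ℝ} (hg0 : ∀ R, 0 ≤ g R)
    (hg : ∀ e ∈ S, ∀ R, e ∈ R → L ≤ g R) :
    L * (1 - ∏ e ∈ S, (1 - p e)) ≤ expectRandomSubset p S g := by
  induction S using Finset.induction_on with
  | empty => simpa [expectRandomSubset] using hg0 ∅
  | insert e S he ih =>
    rw [expectRandomSubset_insert p he, Finset.prod_insert he]
    have a : L ≤ expectRandomSubset p S (fun R => g (insert e R)) := by
      rw [← expectRandomSubset_const p S L]
      exact expectRandomSubset_mono h0 h1 fun R _ => hg e (by simp) _ (by simp)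
    have b := mul_le_mul_of_nonneg_left (ih fun x hx => hg x (Finset.mem_insert_of_mem hx))
      (sub_nonneg.2 (h1 e))
    have := mul_le_mul_of_nonneg_left a (h0 e)
    linarith

/-- The events that `e` is the only active element are disjoint, and each has probability at least
`p e` times the full product. -/
theorem prod_mul_sum_le_expectRandomSubset {p : X → ℝ} (h0 : ∀ e, 0 ≤ p e)
    (h1 : ∀ e, p e ≤ 1) {S : Finset X} {g : Finset X → ℝ} {v : X → ℝ} (hv : ∀ e, 0 ≤ v e)
    (hg0 : ∀ R, 0 ≤ g R) (hg : ∀ e ∈ S, ∀ R, e ∈ R → v e ≤ g R) :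
    (∏ e ∈ S, (1 - p e)) * ∑ e ∈ S, p e * v e ≤ expectRandomSubset p S g := by
  induction S using Finset.induction_on with
  | empty => simpa [expectRandomSubset] using hg0 ∅
  | insert e S he ih =>
    rw [expectRandomSubset_insert p he]
    have a : v e ≤ expectRandomSubset p S (fun R => g (insert e R)) := by
      rw [← expectRandomSubset_const p S (v e)]
      exact expectRandomSubset_mono h0 h1 fun R _ => hg e (by simp) _ (by simp)
    have b := mul_le_mul_of_nonneg_left (ih fun x hx => hg x (Finset.mem_insert_of_mem hx))
      (sub_nonneg.2 (h1 e))
    have a' := mul_le_mul_of_nonneg_left a (h0 e)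
    have q := mul_le_of_le_one_left (mul_nonneg (h0 e) (hv e))
      (prod_one_sub_mem_Icc h0 h1 (insert e S)).2
    rw [Finset.prod_insert he] at q ⊢
    rw [Finset.sum_insert he]
    linarith

/-- If the weights exceed twice the expectation of `g`, the expected weight is controlled by the
expectation of `g`. -/
theorem sum_large_le_of_expectRandomSubset_le {p : X → ℝ} (h0 : ∀ e, 0 ≤ p e)
    (h1 : ∀ e, p e ≤ 1) {S : Finset X} {g : Finset X → ℝ} {v : X → ℝ} {N : ℝ} (hN : 0 < N)
    (hg0 : ∀ R, 0 ≤ g R) (hv : ∀ e, 0 ≤ v e) (hvN : ∀ e ∈ S, 2 * N ≤ v e)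
    (hg : ∀ e R, e ∈ R → v e ≤ g R) (hE : expectRandomSubset p S g ≤ N) :
    ∑ e ∈ S, p e * v e ≤ 2 * N := by
  have a := (mul_one_sub_prod_le_expectRandomSubset h0 h1 (L := 2 * N) hg0
    fun e he R hR => (hvN e he).trans (hg e R hR)).trans hE
  have b := (prod_mul_sum_le_expectRandomSubset h0 h1 hv hg0 fun e _ R hR => hg e R hR).trans hE
  -- Otherwise some element is active with probability above 1/2, and value at least `2 * N` there
  -- contradicts `hE`.
  have hq : 1 / 2 ≤ ∏ e ∈ S, (1 - p e) := by
    by_contra! h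
    nlinarith
  have := mul_le_mul_of_nonneg_right hq
    (Finset.sum_nonneg fun e _ => mul_nonneg (h0 e) (hv e) : 0 ≤ ∑ e ∈ S, p e * v e)
  linarith

end RandomSubset

/-! ### The logarithmic upper bound for XOS objectives -/

section XOS

variable {X : Type*}

theorem IsMaxOfLinear.monotone {f : Finset X → ℝ} {W : ℕ} (h : IsMaxOfLinear f W) :
    Monotone f := by
  obtain ⟨a, ha, hf⟩ := h
  intro S T hST
  obtain ⟨i, hi⟩ := (hf S).1
  rw [← hi]
  exact (Finset.sum_le_sum_of_subset_of_nonneg hST fun e _ _ => ha i e).trans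
    ((hf T).2 ⟨i, rfl⟩)

theorem fMax_eq_of_monotone {f : Finset X → ℝ} (h : Monotone f) : fMax f = f := by
  funext S
  exact le_antisymm (Finset.sup'_le _ _ fun T hT => h (Finset.mem_powerset.1 hT))
    (Finset.le_sup' f (Finset.mem_powerset_self S))

/-- A linearised soft maximum: the tangent bound for `exp` at `z i = log W`. Being linear in the
exponentials, it passes to expectations without Jensen's inequality. -/
theorem le_sum_exp_div_add_log {W : ℕ} (z : Fin W → ℝ) (i : Fin W) :
    z i ≤ (∑ j, Real.exp (z j)) * (W : ℝ)⁻¹ + (Real.log W - 1) := by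
  have hW : (0 : ℝ) < W := by exact_mod_cast (Nat.zero_le _).trans_lt i.isLt
  have h1 : Real.exp (z i) ≤ ∑ j, Real.exp (z j) :=
    Finset.single_le_sum (f := fun j => Real.exp (z j)) (fun j _ => (Real.exp_pos _).le)
      (Finset.mem_univ i)
  have h2 := Real.add_one_le_exp (z i - Real.log W)
  rw [Real.exp_sub, Real.exp_log hW, div_eq_mul_inv] at h2
  have := mul_le_mul_of_nonneg_right h1 (inv_nonneg.2 hW.le)
  linarith

variable [DecidableEq X]

theorem ProbingInstance.adap_le_of_nonadap_le (I : ProbingInstance X) {W : ℕ}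
    (hI : IsMaxOfLinear I.f W) {N : ℝ} (hN : 0 < N)
    (hnon : ∀ σ, I.FeasibleSeq σ → I.nonadap σ ≤ N) {T : StrategyTree X}
    (hT : I.FeasibleTree T) : I.adap T ≤ 4 * (1 + Real.log W) * N := by
  classical
  have hmono := hI.monotone
  obtain ⟨a, ha, hf⟩ := hI
  have h0 := I.p_nonneg
  have h1 := I.p_le_one
  have hW : 0 < W := by
    obtain ⟨i, -⟩ := (hf ∅).1
    exact (Nat.zero_le _).trans_lt i.isLt
  have hav : ∀ i e, a i e ≤ I.f {e} := fun i e => by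
    have := (hf {e}).2 ⟨i, rfl⟩
    simpa using this
  set L := 2 * N with hL
  have hL0 : 0 < L := by positivity
  -- The small part is rescaled into `[0, 1]` for the supermartingale bound; the large part `u` does
  -- not depend on the linear function.
  set b : Fin W → X → ℝ := fun i e => if I.f {e} < L then a i e / L else 0 with hb
  set u : X → ℝ := fun e => if I.f {e} < L then 0 else I.f {e} with hu
  have hb0 : ∀ i e, 0 ≤ b i e := fun i e => by
    simp only [hb]; split_ifs
    exacts [div_nonneg (ha i e) hL0.le, le_rfl]
  have hb1 : ∀ i e, b i e ≤ 1 := fun i e => by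
    simp only [hb]; split_ifs with h
    exacts [(div_le_one hL0).2 ((hav i e).trans h.le), zero_le_one]
  have hbL : ∀ i e, L * b i e ≤ a i e := fun i e => by
    simp only [hb]; split_ifs
    · rw [mul_div_cancel₀ _ hL0.ne']
    · simpa using ha i e
  have hu0 : ∀ e, 0 ≤ u e := fun e => by
    simp only [hu]; split_ifs
    exacts [le_rfl, I.f_nonneg _]
  have hdec : ∀ i e, a i e ≤ L * b i e + u e := fun i e => by
    simp only [hb, hu]; split_ifs
    · rw [mul_div_cancel₀ _ hL0.ne']; simp
    · simpa using hav i e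
  have hseq : ∀ P ∈ T.rootLeafPaths, P.Nodup ∧ expectRandomSubset I.p P.toFinset I.f ≤ N :=
    fun P hP => ⟨(hT P hP).1, by
      have := hnon P (hT P hP)
      rwa [ProbingInstance.nonadap, fMax_eq_of_monotone hmono] at this⟩
  -- Probing `P` non-adaptively earns at least the mean of any single linear function.
  have hmean : ∀ P ∈ T.rootLeafPaths, ∀ i, L * (P.map fun e => I.p e * b i e).sum ≤ N := by
    intro P hP i
    obtain ⟨hnd, hE⟩ := hseq P hP
    rw [← List.sum_toFinset _ hnd, Finset.mul_sum]
    refine le_trans ?_ (le_trans (expectRandomSubset_mono h0 h1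
      (g := fun R => ∑ e ∈ R, a i e) fun R _ => (hf R).2 ⟨i, rfl⟩) hE)
    rw [expectRandomSubset_sum]
    refine Finset.sum_le_sum fun e _ => ?_
    have := mul_le_mul_of_nonneg_left (hbL i e) (h0 e)
    linarith
  have hlarge : ∀ P ∈ T.rootLeafPaths, (P.map fun e => I.p e * u e).sum ≤ 2 * N := by
    intro P hP
    obtain ⟨hnd, hE⟩ := hseq P hP
    rw [← List.sum_toFinset _ hnd]
    have hsub : P.toFinset.filter (fun e => ¬ I.f {e} < L) ⊆ P.toFinset :=
      Finset.filter_subset _ _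
    have := sum_large_le_of_expectRandomSubset_le h0 h1 (v := fun e => I.f {e}) hN I.f_nonneg
      (fun e => I.f_nonneg _) (S := P.toFinset.filter (fun e => ¬ I.f {e} < L))
      (fun e he => not_lt.1 (Finset.mem_filter.1 he).2)
      (fun e R he => hmono (Finset.singleton_subset_iff.2 he))
      ((expectRandomSubset_subset h0 h1 hsub hmono).trans hE)
    refine le_trans (le_of_eq ?_) this
    rw [Finset.sum_filter]
    refine Finset.sum_congr rfl fun e _ => ?_
    simp only [hu]; split_ifs <;> simp_all
  set Z : Fin W → List X → Finset X → ℝ := fun i P A =>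
    ∑ e ∈ A, b i e - 2 * (P.map fun e => I.p e * b i e).sum with hZ
  -- In expectation the three terms are at most `L`, `L * (log W - 1) + 2 * N` and `2 * N`, hence `2
  -- * N * log W + 4 * N` in total.
  have hpt : ∀ P ∈ T.rootLeafPaths, ∀ A, I.f A ≤
      L * (W : ℝ)⁻¹ * (∑ j, Real.exp (Z j P A)) + (L * (Real.log W - 1) + 2 * N) +
        ∑ e ∈ A, u e := by
    intro P hP A
    obtain ⟨i, hi⟩ := (hf A).1
    have e1 : I.f A ≤ L * ∑ e ∈ A, b i e + ∑ e ∈ A, u e := by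
      rw [← hi, Finset.mul_sum, ← Finset.sum_add_distrib]
      exact Finset.sum_le_sum fun e _ => hdec i e
    have e2 := mul_le_mul_of_nonneg_left (le_sum_exp_div_add_log (fun j => Z j P A) i) hL0.le
    have e3 := hmean P hP i
    simp only [hZ] at e2 ⊢
    linarith
  rw [ProbingInstance.adap, fMax_eq_of_monotone hmono, StrategyTree.expect_eq_expectPath]
  refine (StrategyTree.expectPath_mono h0 h1 T hpt).trans ?_
  rw [StrategyTree.expectPath_add, StrategyTree.expectPath_add, StrategyTree.expectPath_const,
    StrategyTree.expectPath_const_mul, StrategyTree.expectPath_sum]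
  have f1 : ∑ j, T.expectPath I.p (fun P A => Real.exp (Z j P A)) ≤ W := by
    refine (Finset.sum_le_sum fun j _ =>
      T.expectPath_exp_le_one h0 h1 (hb0 j) (hb1 j)).trans ?_
    simp
  have f2 : T.expectPath I.p (fun _ A => ∑ e ∈ A, u e) ≤ 2 * N := by
    refine (T.expectPath_sum_active_le h0 h1 hu0).trans ?_
    rw [← StrategyTree.expectPath_const I.p T (2 * N)]
    exact StrategyTree.expectPath_mono h0 h1 T fun P hP _ => hlarge P hP
  have hWr : (0 : ℝ) < W := by exact_mod_cast hW
  have f3 : L * (W : ℝ)⁻¹ * ∑ j, T.expectPath I.p (fun P A => Real.exp (Z j P A)) ≤ L := by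
    refine (mul_le_mul_of_nonneg_left f1 (by positivity)).trans (le_of_eq ?_)
    field_simp
  have hlog : 0 ≤ Real.log W := Real.log_natCast_nonneg W
  have := mul_nonneg hlog hN.le
  linarith

theorem ProbingInstance.adaptivityGap_le_of_isMonotoneXOS (I : ProbingInstance X)
    (hI : IsMonotoneXOS I.f) :
    I.adaptivityGap ≤ ENNReal.ofReal (4 * (1 + Real.log (xosWidth I.f))) := by
  have hW : IsMaxOfLinear I.f (xosWidth I.f) := Nat.sInf_mem hI
  have hK : 0 < 4 * (1 + Real.log (xosWidth I.f)) := by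
    linarith [Real.log_natCast_nonneg (xosWidth I.f)]
  set K := 4 * (1 + Real.log (xosWidth I.f)) with hKdef
  refine ENNReal.div_le_of_le_mul ?_
  by_cases htop : I.nonadaptiveOpt = ∞
  · rw [htop, ENNReal.mul_top (by simpa using hK)]
    exact le_top
  refine iSup₂_le fun T hT => ?_
  rw [← ENNReal.ofReal_toReal htop, ← ENNReal.ofReal_mul hK.le]
  refine ENNReal.ofReal_le_ofReal ?_
  -- The slack `ε / K` makes the bound on non-adaptive values strictly positive, so a vanishing
  -- non-adaptive optimum needs no separate case.
  refine le_of_forall_pos_le_add fun ε hε => ?_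
  have key := I.adap_le_of_nonadap_le hW (N := I.nonadaptiveOpt.toReal + ε / K)
    (by positivity) (fun σ hσ => ?_) hT
  · rw [← hKdef, mul_add, mul_div_cancel₀ _ hK.ne'] at key
    exact key
  · have h : ENNReal.ofReal (I.nonadap σ) ≤ I.nonadaptiveOpt :=
      le_iSup₂ (f := fun (σ : List X) (_ : I.FeasibleSeq σ) => ENNReal.ofReal (I.nonadap σ)) σ hσ
    have := (ENNReal.ofReal_le_iff_le_toReal htop).1 h
    have : 0 < ε / K := by positivity
    linarith

end XOS

/-! ### The k-ary tree: paths, width and size -/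

section KaryTree

variable {k : ℕ}

/-- The edge at depth `i` of the path from the root to the leaf `l`. -/
def pathEdge (l : Fin k → Fin k) (i : Fin k) : KaryEdge k :=
  ⟨i, fun t => l (Fin.castLE i.isLt t)⟩

theorem KaryEdge.lowerOnPath_iff {l : Fin k → Fin k} {e : KaryEdge k} :
    e.LowerOnPath l ↔ e = pathEdge l e.1 := by
  obtain ⟨i, w⟩ := e
  refine ⟨fun h => ?_, fun h j => ?_⟩
  · exact congrArg (Sigma.mk i) (funext h)
  · exact congrFun (eq_of_heq (Sigma.mk.inj h).2) j

theorem pathEdge_injective (l : Fin k → Fin k) : Function.Injective (pathEdge l) :=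
  fun _ _ h => congrArg Sigma.fst h

theorem mem_karyPath {l : Fin k → Fin k} {e : KaryEdge k} :
    e ∈ karyPath l ↔ e.LowerOnPath l := by
  simp [karyPath]

theorem karyPath_eq_image (l : Fin k → Fin k) :
    karyPath l = Finset.univ.image (pathEdge l) := by
  ext e
  rw [mem_karyPath, KaryEdge.lowerOnPath_iff, Finset.mem_image]
  refine ⟨fun h => ⟨e.1, Finset.mem_univ _, h.symm⟩, ?_⟩
  rintro ⟨i, -, rfl⟩
  rfl

theorem card_karyPath (l : Fin k → Fin k) : (karyPath l).card = k := by
  rw [karyPath_eq_image, Finset.card_image_of_injective _ (pathEdge_injective l),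
    Finset.card_univ, Fintype.card_fin]

theorem karyPath_injective : Function.Injective (karyPath (k := k)) := by
  intro l l' h
  funext i
  have h1 : pathEdge l i ∈ karyPath l' := by
    rw [← h, karyPath_eq_image]; exact Finset.mem_image_of_mem _ (Finset.mem_univ i)
  exact mem_karyPath.1 h1 (Fin.last i)

theorem card_karyPath_inter_le (l : Fin k → Fin k) (S : Finset (KaryEdge k)) :
    ((karyPath l ∩ S).card : ℝ) ≤ (karyInstance k).f S := by
  simp only [karyInstance]
  exact_mod_cast Finset.le_sup (f := fun l : Fin k → Fin k => (karyPath l ∩ S).card)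
    (Finset.mem_univ l)

theorem karyInstance_f_le {S : Finset (KaryEdge k)} {n : ℕ}
    (h : ∀ l : Fin k → Fin k, (karyPath l ∩ S).card ≤ n) : (karyInstance k).f S ≤ n := by
  simp only [karyInstance]
  exact_mod_cast Finset.sup_le fun l _ => h l

/-- One linear function per leaf: the indicator of its path. -/
theorem isMaxOfLinear_karyInstance (k : ℕ) : IsMaxOfLinear (karyInstance k).f (k ^ k) := by
  classical
  have hc : Fintype.card (Fin k → Fin k) = k ^ k := by simp
  let eqv : (Fin k → Fin k) ≃ Fin (k ^ k) := Fintype.equivFinOfCardEq hc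
  have hsum : ∀ i (S : Finset (KaryEdge k)),
      ∑ e ∈ S, (if e ∈ karyPath (eqv.symm i) then (1 : ℝ) else 0) =
        (karyPath (eqv.symm i) ∩ S).card := fun i S => by
    rw [Finset.sum_boole, Finset.filter_mem_eq_inter, Finset.inter_comm]
  refine ⟨fun i e => if e ∈ karyPath (eqv.symm i) then 1 else 0,
    fun i e => by beta_reduce; split_ifs <;> norm_num, fun S => ⟨?_, ?_⟩⟩
  · have hne : (Finset.univ : Finset (Fin k → Fin k)).Nonempty := ⟨id, Finset.mem_univ _⟩
    obtain ⟨l, -, hl⟩ := Finset.exists_mem_eq_sup _ hne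
      (fun l : Fin k → Fin k => (karyPath l ∩ S).card)
    refine ⟨eqv l, ?_⟩
    beta_reduce
    rw [hsum, Equiv.symm_apply_apply]
    simp only [karyInstance]
    exact_mod_cast hl.symm
  · rintro _ ⟨i, rfl⟩
    simp only [hsum]
    exact card_karyPath_inter_le _ S

/-- No linear function can be tight on two different root-leaf paths, so the `k ^ k` leaves need
distinct ones. -/
theorem pow_le_of_isMaxOfLinear_karyInstance {W : ℕ} (h : IsMaxOfLinear (karyInstance k).f W) :
    k ^ k ≤ W := by
  classical
  obtain ⟨a, ha, hf⟩ := h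
  have hle : ∀ S, (karyInstance k).f S ≤ k := fun S => karyInstance_f_le fun l =>
    (Finset.card_le_card Finset.inter_subset_left).trans (card_karyPath l).le
  have hval : ∀ l : Fin k → Fin k, (karyInstance k).f (karyPath l) = k := fun l => by
    refine le_antisymm (hle _) ?_
    have := card_karyPath_inter_le l (karyPath l)
    rwa [Finset.inter_self, card_karyPath] at this
  have hone : ∀ i e, a i e ≤ 1 := fun i e => by
    have h1 : ∑ x ∈ {e}, a i x ≤ (karyInstance k).f {e} := (hf {e}).2 ⟨i, rfl⟩
    rw [Finset.sum_singleton] at h1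
    refine h1.trans ?_
    exact_mod_cast karyInstance_f_le (n := 1) fun l =>
      (Finset.card_le_card Finset.inter_subset_right).trans (Finset.card_singleton e).le
  choose idx hidx using fun l => (hf (karyPath l)).1
  -- The path has `k` edges with coefficients at most 1 that sum to `k`.
  have hact : ∀ l, ∀ e ∈ karyPath l, a (idx l) e = 1 := by
    intro l
    have hs : ∑ e ∈ karyPath l, a (idx l) e = ∑ e ∈ karyPath l, (1 : ℝ) := by
      have := hidx l
      simp only at this
      rw [this, hval]; simp [card_karyPath]
    exact (Finset.sum_eq_sum_iff_of_le fun e _ => hone (idx l) e).1 hs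
  -- A shared function would give the union of the two paths its cardinality as value; since `f`
  -- never exceeds `k`, the paths coincide.
  have hinj : Function.Injective idx := by
    intro l l' hll
    have hs : ∑ e ∈ karyPath l ∪ karyPath l', a (idx l) e = (karyPath l ∪ karyPath l').card := by
      rw [Finset.card_eq_sum_ones, Nat.cast_sum]
      refine Finset.sum_congr rfl fun e he => ?_
      rcases Finset.mem_union.1 he with h | h
      · simpa using hact l e h
      · simpa [hll] using hact l' e h
    have hcard : (karyPath l ∪ karyPath l').card ≤ k := by
      have h1 : ∑ e ∈ karyPath l ∪ karyPath l', a (idx l) e ≤ _ :=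
        (hf (karyPath l ∪ karyPath l')).2 ⟨idx l, rfl⟩
      rw [hs] at h1
      exact_mod_cast h1.trans (hle _)
    apply karyPath_injective
    rw [Finset.eq_of_subset_of_card_le (Finset.subset_union_left (s₂ := karyPath l'))
      (hcard.trans (card_karyPath l).ge)]
    exact (Finset.eq_of_subset_of_card_le (Finset.subset_union_right (s₁ := karyPath l))
      (hcard.trans (card_karyPath l').ge)).symm
  simpa using Fintype.card_le_of_injective idx hinj

theorem xosWidth_karyInstance (k : ℕ) : xosWidth (karyInstance k).f = k ^ k :=
  le_antisymm (Nat.sInf_le (isMaxOfLinear_karyInstance k))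
    (pow_le_of_isMaxOfLinear_karyInstance (Nat.sInf_mem
      (s := {W | IsMaxOfLinear (karyInstance k).f W}) ⟨_, isMaxOfLinear_karyInstance k⟩))

theorem card_karyEdge (k : ℕ) :
    Fintype.card (KaryEdge k) = ∑ i ∈ Finset.range k, k ^ (i + 1) := by
  rw [Fintype.card_sigma, ← Fin.sum_univ_eq_sum_range (fun i => k ^ (i + 1))]
  simp

theorem pow_le_card_karyEdge (hk : 0 < k) : k ^ k ≤ Fintype.card (KaryEdge k) := by
  rw [card_karyEdge]
  obtain ⟨m, rfl⟩ := Nat.exists_eq_add_of_lt hk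
  rw [zero_add]
  exact Finset.single_le_sum (f := fun i => (m + 1) ^ (i + 1)) (fun _ _ => Nat.zero_le _)
    (Finset.self_mem_range_succ m)

theorem card_karyEdge_le (hk : 2 ≤ k) : Fintype.card (KaryEdge k) ≤ 2 * k ^ k := by
  have h : ∀ m, ∑ i ∈ Finset.range m, k ^ (i + 1) ≤ 2 * k ^ m := fun m => by
    induction m with
    | zero => simp
    | succ m ih =>
      rw [Finset.sum_range_succ, pow_succ]
      have := Nat.mul_le_mul_left (k ^ m) hk
      linarith
  rw [card_karyEdge]
  exact h k

/-! ### Non-adaptive strategies on the tree -/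

theorem KaryEdge.LowerOnPath.upperOnPath {l : Fin k → Fin k} {e : KaryEdge k}
    (h : e.LowerOnPath l) : e.UpperOnPath l := fun j => h j.castSucc

/-- Edges hanging off the path to `l` meet another root-leaf path in at most one further edge. -/
theorem karyInstance_f_le_of_upperOnPath {l : Fin k → Fin k} {R : Finset (KaryEdge k)}
    (hR : ∀ e ∈ R, e.UpperOnPath l) :
    (karyInstance k).f R ≤ 1 + ((karyPath l ∩ R).card : ℝ) := by
  have key : (karyInstance k).f R ≤ ((1 + (karyPath l ∩ R).card : ℕ) : ℝ) := by
    refine karyInstance_f_le fun l' => ?_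
    have hsub : karyPath l' ∩ R ⊆ ((karyPath l' ∩ R) \ karyPath l) ∪ (karyPath l ∩ R) := by
      intro e he
      by_cases h : e ∈ karyPath l <;> simp_all
    refine (Finset.card_le_card hsub).trans ((Finset.card_union_le _ _).trans ?_)
    refine Nat.add_le_add_right (Finset.card_le_one.2 ?_) _
    -- If `e'` were deeper, its upper endpoint on the path to `l` would force the edge `e` above it
    -- onto that path.
    have hlt : ∀ e ∈ (karyPath l' ∩ R) \ karyPath l, ∀ e' ∈ (karyPath l' ∩ R) \ karyPath l,
        ¬ e.1 < e'.1 := by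
      intro e he e' he' hlt
      simp only [Finset.mem_sdiff, Finset.mem_inter, mem_karyPath] at he he'
      refine he.2 fun j => ?_
      rw [he.1.1 j]
      have h1 := hR e' he'.1.2 ⟨j, by have := j.isLt; have : e.1.val < e'.1.val := hlt; omega⟩
      rw [he'.1.1] at h1
      exact h1
    intro e he e' he'
    have heq : e.1 = e'.1 :=
      le_antisymm (not_lt.1 (hlt e' he' e he)) (not_lt.1 (hlt e he e' he'))
    simp only [Finset.mem_sdiff, Finset.mem_inter, mem_karyPath] at he he'
    rw [KaryEdge.lowerOnPath_iff.1 he.1.1, KaryEdge.lowerOnPath_iff.1 he'.1.1, heq]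
  push_cast at key
  exact key

/-- One unit pays for an edge off the path, the other for the mean number of active edges among the
`k` path edges. -/
theorem nonadap_karyInstance_le {σ : List (KaryEdge k)}
    (hσ : (karyInstance k).FeasibleSeq σ) : (karyInstance k).nonadap σ ≤ 2 := by
  obtain ⟨-, l, hl⟩ := hσ
  have hup : ∀ e ∈ σ.toFinset, e.UpperOnPath l := fun e he =>
    (hl e (List.mem_toFinset.1 he)).elim id KaryEdge.LowerOnPath.upperOnPath
  rw [ProbingInstance.nonadap, fMax_eq_of_monotone (isMaxOfLinear_karyInstance k).monotone]
  refine (expectRandomSubset_mono (karyInstance k).p_nonneg (karyInstance k).p_le_one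
    (h := fun R => 1 + ∑ e ∈ R, if e ∈ karyPath l then (1 : ℝ) else 0) fun R hR => ?_).trans ?_
  · rw [Finset.sum_boole, Finset.filter_mem_eq_inter, Finset.inter_comm]
    exact karyInstance_f_le_of_upperOnPath fun e he => hup e (hR he)
  · rw [expectRandomSubset_add, expectRandomSubset_const, expectRandomSubset_sum]
    have : ∑ e ∈ σ.toFinset, (karyInstance k).p e * (if e ∈ karyPath l then (1 : ℝ) else 0) ≤
        1 := by
      have hp : ∀ e, (karyInstance k).p e = 1 / k := fun _ => rfl
      simp only [hp]
      rw [← Finset.mul_sum, Finset.sum_boole, Finset.filter_mem_eq_inter]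
      have hc : ((σ.toFinset ∩ karyPath l).card : ℝ) ≤ k := by
        exact_mod_cast (Finset.card_le_card Finset.inter_subset_right).trans (card_karyPath l).le
      rw [one_div, inv_mul_eq_div]
      exact div_le_one_of_le₀ hc (Nat.cast_nonneg k)
    linarith

/-! ### The greedy adaptive descent -/

/-- Probe the edges at depth `i` below the current vertex of `l` leading to the children `js` one
after the other; continue with `next` at the first child reached by an active edge, and at `l` if
there is none. -/
def probeChildren (next : (Fin k → Fin k) → StrategyTree (KaryEdge k)) (i : Fin k)
    (l : Fin k → Fin k) : List (Fin k) → StrategyTree (KaryEdge k)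
  | [] => next l
  | j :: js => .node (pathEdge (Function.update l i j) i) (next (Function.update l i j))
      (probeChildren next i l js)

/-- Descend greedily through the given levels, starting on the path to `l`. -/
def descend : List (Fin k) → (Fin k → Fin k) → StrategyTree (KaryEdge k)
  | [], _ => .leaf
  | i :: is, l => probeChildren (descend is) i l (List.finRange k)

theorem pathEdge_congr {l l' : Fin k → Fin k} {t : Fin k} (h : ∀ s ≤ t, l s = l' s) :
    pathEdge l t = pathEdge l' t :=
  congrArg (Sigma.mk t) (funext fun j => h _ (Fin.le_def.2 (by
    simpa using Nat.le_of_lt_succ j.isLt)))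

theorem pathEdge_upperOnPath {l l' : Fin k → Fin k} {t : Fin k} (h : ∀ s < t, l s = l' s) :
    (pathEdge l t).UpperOnPath l' := fun j => h _ (Fin.lt_def.2 (by
      exact j.isLt))

theorem pathEdge_update_injective (l : Fin k → Fin k) (i : Fin k) :
    Function.Injective fun j => pathEdge (Function.update l i j) i := by
  intro j j' h
  have h2 := congrFun (eq_of_heq (Sigma.mk.inj h).2) (Fin.last i)
  have h3 : Fin.castLE i.isLt (Fin.last i.val) = i := rfl
  simpa [h3] using h2

/-- Later probes are strictly deeper than `i`, which rules out repetitions. The final leaf `l'`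
agrees with `l` above level `i`, so all sibling edges probed there, active or not, start on its
path. -/
theorem probeChildren_paths {next : (Fin k → Fin k) → StrategyTree (KaryEdge k)} {i : Fin k}
    (hnext : ∀ l, ∀ P ∈ (next l).rootLeafPaths, P.Nodup ∧ (∀ e ∈ P, i < e.1) ∧
      ∃ l', (∀ t ≤ i, l' t = l t) ∧ ∀ e ∈ P, e.UpperOnPath l')
    (l : Fin k → Fin k) (js : List (Fin k)) (hjs : js.Nodup) :
    ∀ P ∈ (probeChildren next i l js).rootLeafPaths, P.Nodup ∧
      (∀ e ∈ P, (∃ j ∈ js, e = pathEdge (Function.update l i j) i) ∨ i < e.1) ∧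
      ∃ l', (∀ t < i, l' t = l t) ∧ ∀ e ∈ P, e.UpperOnPath l' := by
  induction js with
  | nil =>
    intro P hP
    obtain ⟨h1, h2, l', h3, h4⟩ := hnext l P hP
    exact ⟨h1, fun e he => .inr (h2 e he), l', fun t ht => h3 t ht.le, h4⟩
  | cons j js ih =>
    intro P hP
    obtain ⟨hj, hjs⟩ := List.nodup_cons.1 hjs
    simp only [probeChildren, StrategyTree.rootLeafPaths, List.mem_map, List.mem_append] at hP
    obtain ⟨Q, hQ | hQ, rfl⟩ := hP
    · obtain ⟨h1, h2, l', h3, h4⟩ := hnext _ Q hQ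
      have hl' : ∀ t < i, l' t = l t := fun t ht => by
        rw [h3 t ht.le, Function.update_of_ne ht.ne]
      refine ⟨List.nodup_cons.2 ⟨fun h => lt_irrefl _ (h2 _ h), h1⟩, fun e he => ?_, l', hl',
        fun e he => ?_⟩
      · rcases List.mem_cons.1 he with rfl | he
        · exact .inl ⟨j, by simp, rfl⟩
        · exact .inr (h2 e he)
      · rcases List.mem_cons.1 he with rfl | he
        · exact pathEdge_upperOnPath fun s hs => (h3 s hs.le).symm
        · exact h4 e he
    · obtain ⟨h1, h2, l', h3, h4⟩ := ih hjs Q hQ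
      refine ⟨List.nodup_cons.2 ⟨fun h => ?_, h1⟩, fun e he => ?_, l', h3, fun e he => ?_⟩
      · rcases h2 _ h with ⟨j', hj', heq⟩ | hlt
        · exact hj (pathEdge_update_injective l i heq ▸ hj')
        · exact lt_irrefl _ hlt
      · rcases List.mem_cons.1 he with rfl | he
        · exact .inl ⟨j, by simp, rfl⟩
        · rcases h2 e he with ⟨j', hj', heq⟩ | hlt
          · exact .inl ⟨j', List.mem_cons_of_mem _ hj', heq⟩
          · exact .inr hlt
      · rcases List.mem_cons.1 he with rfl | he
        · exact pathEdge_upperOnPath fun s hs => by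
            rw [h3 s hs, Function.update_of_ne hs.ne]
        · exact h4 e he

theorem descend_paths (is : List (Fin k)) (his : is.Pairwise (· < ·)) (i : Fin k)
    (hi : ∀ s ∈ is, i < s) (l : Fin k → Fin k) :
    ∀ P ∈ (descend is l).rootLeafPaths, P.Nodup ∧ (∀ e ∈ P, i < e.1) ∧
      ∃ l', (∀ t ≤ i, l' t = l t) ∧ ∀ e ∈ P, e.UpperOnPath l' := by
  induction is generalizing i l with
  | nil =>
    intro P hP
    simp only [descend, StrategyTree.rootLeafPaths, List.mem_singleton] at hP
    subst hP
    exact ⟨List.nodup_nil, by simp, l, fun _ _ => rfl, by simp⟩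
  | cons i' is ih =>
    obtain ⟨hi', his⟩ := List.pairwise_cons.1 his
    have hii' : i < i' := hi i' (by simp)
    intro P hP
    obtain ⟨h1, h2, l', h3, h4⟩ := probeChildren_paths (fun l => ih his i' hi' l) l _
      (List.nodup_finRange k) P hP
    refine ⟨h1, fun e he => ?_, l', fun t ht => h3 t (ht.trans_lt hii'), h4⟩
    rcases h2 e he with ⟨j, -, rfl⟩ | h
    · exact hii'
    · exact hii'.trans h

theorem feasibleTree_descend (l : Fin k → Fin k) :
    (karyInstance k).FeasibleTree (descend (List.finRange k) l) := by
  have hs := List.pairwise_lt_finRange k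
  intro P hP
  -- `descend_paths` needs a level strictly above the list; none exists above the root, so the first
  -- level is opened by hand.
  cases hfr : List.finRange k with
  | nil =>
    rw [hfr] at hP
    simp only [descend, StrategyTree.rootLeafPaths, List.mem_singleton] at hP
    subst hP
    exact ⟨List.nodup_nil, (karyInstance k).nil_allowed⟩
  | cons i is =>
    rw [hfr] at hP hs
    obtain ⟨hi, his⟩ := List.pairwise_cons.1 hs
    obtain ⟨h1, -, l', -, h4⟩ := probeChildren_paths (fun l => descend_paths is his i hi l) l _
      (List.nodup_finRange k) P hP
    exact ⟨h1, l', fun e he => .inl (h4 e he)⟩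

/-- The active edges in `B` on the path to `l` strictly above all the levels in `is`. -/
def activeAbove (is : List (Fin k)) (l : Fin k → Fin k) (B : Finset (KaryEdge k)) :
    Finset (Fin k) :=
  Finset.univ.filter fun t => (∀ s ∈ is, t < s) ∧ pathEdge l t ∈ B

/-- Here `B` holds edges already found active and `q` is the guaranteed gain from the deeper levels.
Level `i` adds one unit as soon as some child edge is active, which has probability `1 - (1 - p) ^
js.length`. -/
theorem le_expect_probeChildren {next : (Fin k → Fin k) → StrategyTree (KaryEdge k)} {i : Fin k}
    {is : List (Fin k)} (his : ∀ s ∈ is, i < s) {q p : ℝ} (h0 : 0 ≤ p) (h1 : p ≤ 1)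
    {g : Finset (KaryEdge k) → ℝ}
    (hnext : ∀ l B, ((activeAbove is l B).card : ℝ) + q ≤
      (next l).expect (fun _ => p) (fun A => g (A ∪ B)))
    (l : Fin k → Fin k) (B : Finset (KaryEdge k)) (js : List (Fin k)) :
    ((activeAbove (i :: is) l B).card : ℝ) + q + (1 - (1 - p) ^ js.length) ≤
      (probeChildren next i l js).expect (fun _ => p) (fun A => g (A ∪ B)) := by
  induction js with
  | nil =>
    refine le_trans ?_ (hnext l B)
    have : (activeAbove (i :: is) l B).card ≤ (activeAbove is l B).card :=
      Finset.card_le_card fun t => by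
        simp only [activeAbove, Finset.mem_filter, List.mem_cons]
        exact fun h => ⟨h.1, fun s hs => h.2.1 s (.inr hs), h.2.2⟩
    have : ((activeAbove (i :: is) l B).card : ℝ) ≤ (activeAbove is l B).card := by
      exact_mod_cast this
    simpa using this
  | cons j js ih =>
    set l' := Function.update l i j with hl'
    set e := pathEdge l' i with he
    have hy := hnext l' (insert e B)
    -- Level `i` starts to count once it leaves the list; the levels above it are unaffected by the
    -- update at `i`.
    have hcard : (activeAbove (i :: is) l B).card + 1 ≤ (activeAbove is l' (insert e B)).card := by
      have hi : i ∉ activeAbove (i :: is) l B := by simp [activeAbove]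
      rw [← Finset.card_insert_of_notMem hi]
      refine Finset.card_le_card fun t ht => ?_
      simp only [activeAbove, Finset.mem_insert, Finset.mem_filter, Finset.mem_univ, true_and,
        List.mem_cons, forall_eq_or_imp] at ht ⊢
      rcases ht with rfl | ⟨⟨hti, hts⟩, htB⟩
      · exact ⟨his, .inl rfl⟩
      · refine ⟨hts, .inr ?_⟩
        rwa [pathEdge_congr (l' := l) fun s hs => ?_]
        rw [hl', Function.update_of_ne (hs.trans_lt hti).ne]
    have hcard' : ((activeAbove (i :: is) l B).card : ℝ) + 1 ≤
        (activeAbove is l' (insert e B)).card := by exact_mod_cast hcard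
    have hunion : ∀ A, g (A ∪ insert e B) = g (insert e A ∪ B) := fun A => by
      rw [Finset.union_insert, Finset.insert_union]
    simp only [hunion] at hy
    simp only [probeChildren, StrategyTree.expect, List.length_cons, pow_succ]
    have a := mul_le_mul_of_nonneg_left hy h0
    have b := mul_le_mul_of_nonneg_left ih (sub_nonneg.2 h1)
    have c := mul_le_mul_of_nonneg_left hcard' h0
    linarith

theorem le_expect_descend {p : ℝ} (h0 : 0 ≤ p) (h1 : p ≤ 1) (is : List (Fin k))
    (his : is.Pairwise (· < ·)) (l : Fin k → Fin k) (B : Finset (KaryEdge k)) :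
    ((activeAbove is l B).card : ℝ) + is.length * (1 - (1 - p) ^ k) ≤
      (descend is l).expect (fun _ => p) (fun A => (karyInstance k).f (A ∪ B)) := by
  induction is generalizing l B with
  | nil =>
    simp only [descend, StrategyTree.expect, Finset.empty_union, List.length_nil, Nat.cast_zero,
      zero_mul, add_zero]
    refine le_trans ?_ (card_karyPath_inter_le l B)
    have : (activeAbove [] l B).card ≤ (karyPath l ∩ B).card := by
      refine Finset.card_le_card_of_injOn (pathEdge l) (fun t ht => ?_)
        (pathEdge_injective l).injOn
      have ht' := (Finset.mem_filter.1 ht).2.2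
      rw [karyPath_eq_image]
      exact Finset.mem_inter.2 ⟨Finset.mem_image_of_mem _ (Finset.mem_univ t), ht'⟩
    exact_mod_cast this
  | cons i is ih =>
    obtain ⟨hi, his⟩ := List.pairwise_cons.1 his
    have := le_expect_probeChildren (next := descend is) hi h0 h1 (ih his) l B (List.finRange k)
    rw [List.length_finRange] at this
    simp only [descend, List.length_cons, Nat.cast_add, Nat.cast_one]
    linarith

theorem half_le_adap_descend (hk : 0 < k) (l : Fin k → Fin k) :
    (k : ℝ) / 2 ≤ (karyInstance k).adap (descend (List.finRange k) l) := by
  have hk1 : (1 : ℝ) ≤ k := by exact_mod_cast hk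
  have h := le_expect_descend (p := 1 / (k : ℝ)) (by positivity)
    ((div_le_one (by linarith)).2 hk1) (List.finRange k) (List.pairwise_lt_finRange k) l ∅
  simp only [Finset.union_empty, List.length_finRange] at h
  rw [ProbingInstance.adap, fMax_eq_of_monotone (isMaxOfLinear_karyInstance k).monotone]
  refine le_trans ?_ h
  have h2 := Real.one_sub_div_pow_le_exp_neg (n := k) (t := 1) hk1
  -- The chance of success per level is at least `1 - 1 / e`, which exceeds 1/2.
  have h3 := Real.exp_neg_one_lt_d9
  have h4 : (1 : ℝ) / 2 ≤ 1 - (1 - 1 / (k : ℝ)) ^ k := by linarith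
  have := mul_le_mul_of_nonneg_left h4 (Nat.cast_nonneg (α := ℝ) k)
  have := Nat.cast_nonneg (α := ℝ) (activeAbove (List.finRange k) l ∅).card
  linarith

/-! ### Comparing the gap with the width -/

theorem le_adaptivityGap_karyInstance (hk : 0 < k) :
    ENNReal.ofReal ((k : ℝ) / 4) ≤ (karyInstance k).adaptivityGap := by
  have h1 : ENNReal.ofReal ((k : ℝ) / 2) ≤ (karyInstance k).adaptiveOpt :=
    (ENNReal.ofReal_le_ofReal (half_le_adap_descend hk id)).trans
      (le_iSup₂ (f := fun T (_ : (karyInstance k).FeasibleTree T) =>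
        ENNReal.ofReal ((karyInstance k).adap T)) _ (feasibleTree_descend id))
  have h2 : (karyInstance k).nonadaptiveOpt ≤ ENNReal.ofReal 2 :=
    iSup₂_le fun σ hσ => ENNReal.ofReal_le_ofReal (nonadap_karyInstance_le hσ)
  refine le_trans (le_of_eq ?_) (ENNReal.div_le_div h1 h2)
  rw [← ENNReal.ofReal_div_of_pos two_pos]
  congr 1
  ring

theorem log_div_log_log_pow_self_le (hk : 2 ≤ k) :
    Real.log ((k ^ k : ℕ) : ℝ) / Real.log (Real.log ((k ^ k : ℕ) : ℝ)) ≤ 4 * k := by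
  rw [Nat.cast_pow, Real.log_pow]
  have l2 := Real.log_two_gt_d9
  have l2' := Real.log_two_lt_d9
  -- For `k ≥ 3`, `log k ≥ 1` already bounds the ratio by `k`. This fails at `k = 2`, where `log
  -- (log 4) ≥ 1 / 4` suffices for the constant 4.
  rcases hk.eq_or_lt with rfl | hk3
  · have h1 := Real.one_sub_inv_le_log_of_pos (x := ((2 : ℕ) : ℝ) * Real.log ((2 : ℕ) : ℝ))
      (by push_cast; linarith)
    push_cast at h1 ⊢
    have h2 : (2 * Real.log 2)⁻¹ ≤ 3 / 4 :=
      inv_le_of_inv_le₀ (by norm_num) (by norm_num; linarith)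
    rw [div_le_iff₀ (by linarith)]
    linarith
  · have hk3' : (3 : ℝ) ≤ k := by exact_mod_cast hk3
    have hlog : 1 ≤ Real.log k := by
      rw [Real.le_log_iff_exp_le (by linarith)]
      linarith [Real.exp_one_lt_d9]
    have h2 : Real.log k ≤ Real.log (k * Real.log k) :=
      Real.log_le_log (by linarith) (le_mul_of_one_le_right (by linarith) hlog)
    rw [div_le_iff₀ (by linarith)]
    have := mul_le_mul_of_nonneg_left h2 (by linarith : (0 : ℝ) ≤ k)
    have : 0 ≤ k * Real.log (k * Real.log k) := mul_nonneg (by linarith) (by linarith)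
    linarith

end KaryTree

theorem mainTheorem3 :
    (∃ C : ℝ, 0 < C ∧
      ∀ (X : Type*) [Fintype X] [DecidableEq X] (I : ProbingInstance X), IsMonotoneXOS I.f →
        I.adaptivityGap ≤ ENNReal.ofReal (C * (1 + Real.log (xosWidth I.f)))) ∧
    (∃ c c₁ c₂ : ℝ, 0 < c ∧ 0 < c₁ ∧ 0 < c₂ ∧
      ∀ k : ℕ, 2 ≤ k →
        IsMonotoneXOS (karyInstance k).f ∧
        c₁ * (Fintype.card (KaryEdge k) : ℝ) ≤ (xosWidth (karyInstance k).f : ℝ) ∧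
        (xosWidth (karyInstance k).f : ℝ) ≤ c₂ * (Fintype.card (KaryEdge k) : ℝ) ∧
        ENNReal.ofReal (c * (Real.log (xosWidth (karyInstance k).f) /
          Real.log (Real.log (xosWidth (karyInstance k).f)))) ≤
            (karyInstance k).adaptivityGap) := by
  refine ⟨⟨4, by norm_num, fun X _ _ I hI => I.adaptivityGap_le_of_isMonotoneXOS hI⟩,
    1 / 16, 1 / 2, 1, by norm_num, by norm_num, by norm_num, fun k hk => ?_⟩
  rw [xosWidth_karyInstance]
  refine ⟨⟨_, isMaxOfLinear_karyInstance k⟩, ?_, ?_, ?_⟩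
  · have : (Fintype.card (KaryEdge k) : ℝ) ≤ 2 * ((k ^ k : ℕ) : ℝ) := by
      exact_mod_cast card_karyEdge_le hk
    linarith
  · rw [one_mul]
    exact_mod_cast pow_le_card_karyEdge (by omega : 0 < k)
  · refine le_trans (ENNReal.ofReal_le_ofReal ?_)
      (le_adaptivityGap_karyInstance (by omega : 0 < k))
    linarith [log_div_log_log_pow_self_le hk]
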